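/- CTL formulas are built from propositions and the constants $\top,\bot$ by $\land,\lor,\lnot$ and the operators $\mathsf{P}\mathsf{T}\varphi$ and $\mathsf{P}[\varphi\,\mathsf{U}\,\psi]$ with $\mathsf P\in\{\mathsf A,\mathsf E\}$, $\mathsf T\in\{\mathsf X,\mathsf F,\mathsf G\}$. They are interpreted, with the usual path semantics, in Kripke structures with a finite set of worlds and a total successor relation; $\varphi$ is satisfiable if it holds at some world of such a structure. The temporal depth $\mathrm{td}(\varphi)$ is the maximal nesting depth of CTL-operators in $\varphi$. A formula is in negation normal form if $\lnot$ occurs only in front of propositions. Let $\tau$ be the finite relational vocabulary with the unary symbols $\mathrm{const}_\top,\mathrm{const}_\bot,\mathrm{var},\mathrm{repr},\mathrm{repr}_{\mathrm{PL}}$, and $\mathrm{repr}_{\mathsf C}$ for each CTL-operator $\mathsf C$; the binary symbols $\mathrm{conn}_{\land,1},\mathrm{conn}_{\land,2},\mathrm{conn}_{\lor,1},\mathrm{conn}_{\lor,2},\mathrm{conn}_{\lnot,1}$, and $\mathrm{body}_{\mathsf C}$ for each unary CTL-operator $\mathsf C$; and the ternary symbols $\mathrm{body}_{\mathsf C}$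 for $\mathsf C\in\{\mathsf{AU},\mathsf{EU}\}$. The $\tau$-structure $\mathcal A_\varphi$ has the set of subformulas of $\varphi$ (including $\varphi$) as its universe; $\mathrm{const}_f(x)$, $\mathrm{var}(x)$, $\mathrm{repr}(x)$, $\mathrm{repr}_{\mathrm{PL}}(x)$, $\mathrm{repr}_{\mathsf C}(x)$ hold iff $x$ is, respectively, the constant $f$, a proposition, the formula $\varphi$, a formula without CTL-operators, a formula with outermost operator $\mathsf C$; $\mathrm{conn}_{f,i}(x,y)$ holds iff $y$ has outermost connective $f$ and $x$ is its $i$-th argument; $\mathrm{body}_{\mathsf C}(y,x)$ holds iff $x=\mathsf C y$; and $\mathrm{body}_{\mathsf C}(y,z,x)$ holds iff $x=\mathsf C(y,z)$. More generally, a finite $\tau$-structure $\mathcal A$ encodes $\varphi$ if each of its elements represents a subformula of $\varphi$, each subformula is represented, $\varphi$ and each proposition are represented by only one element, the unary predicates hold as above for the represented formulas, and the relations $\mathrm{conn}_{f,i}$, $\mathrm{body}_{\mathsf C}$ relate each element whose formula has the outermost symbol $f$ or $\mathsf C$ to exactly one element (pair of elements, if $\mathsf C$ is binary) representing the corresponding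 argument(s), and contain no other tuples. For example, $\mathcal A_\varphi$ encodes $\varphi$, and so does the syntax tree of $\varphi$ with all leaves carrying the same proposition identified. **Lemma.** There is a computable sequence $(\theta_d)_{d\in\mathbb N}$ of sentences of monadic second-order logic over $\tau$ such that, for every CTL formula $\varphi$ in negation normal form whose only CTL-operators are $\mathsf{AX}$ and $\mathsf{EX}$, $$\varphi \text{ is satisfiable}\iff \mathcal A_\varphi\models\theta_{\mathrm{td}(\varphi)},$$ and likewise $\varphi$ is satisfiable iff $\mathcal A\models\theta_{\mathrm{td}(\varphi)}$, for every finite $\tau$-structure $\mathcal A$ that encodes $\varphi$. -/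

import Mathlib

namespace CTL

/-! ### Formulas of computation tree logic -/

/-- Path quantifiers: all paths, some path. -/
inductive PathQ
  | A
  | E

/-- Unary temporal operators: next, future, globally. -/
inductive TempOp
  | X
  | F
  | G

/-- CTL formulas over the propositions `0, 1, 2, …`. `un q t φ` is `q t φ` (for instance
`un .A .X φ` is `AX φ`) and `bin q φ ψ` is `q[φ U ψ]`. -/
inductive Formula
  | top
  | bot
  | var (p : ℕ)
  | neg (φ : Formula)
  | and (φ ψ : Formula)
  | or (φ ψ : Formula)
  | un (q : PathQ) (t : TempOp) (φ : Formula)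
  | bin (q : PathQ) (φ ψ : Formula)

/-- CTL-operators: a path quantifier followed by a temporal operator. -/
inductive Operator
  | un (q : PathQ) (t : TempOp)
  | untl (q : PathQ)

/-- The operator `AX`. -/
def opAX : Operator := .un .A .X

/-- The operator `EX`. -/
def opEX : Operator := .un .E .X

namespace Formula

/-- All CTL-operators that occur in the formula belong to `T`. -/
def UsesOnly (T : Set Operator) : Formula → Prop
  | top => True
  | bot => True
  | var _ => True
  | neg φ => φ.UsesOnly T
  | and φ ψ => φ.UsesOnly T ∧ ψ.UsesOnly T
  | or φ ψ => φ.UsesOnly T ∧ ψ.UsesOnly T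
  | un q t φ => Operator.un q t ∈ T ∧ φ.UsesOnly T
  | bin q φ ψ => Operator.untl q ∈ T ∧ φ.UsesOnly T ∧ ψ.UsesOnly T

/-- Negation normal form: negations occur only in front of propositions. -/
def IsNNF : Formula → Prop
  | top => True
  | bot => True
  | var _ => True
  | neg φ => ∃ p, φ = var p
  | and φ ψ => φ.IsNNF ∧ ψ.IsNNF
  | or φ ψ => φ.IsNNF ∧ ψ.IsNNF
  | un _ _ φ => φ.IsNNF
  | bin _ φ ψ => φ.IsNNF ∧ ψ.IsNNF

/-- Propositional formulas: no CTL-operator occurs. -/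
def IsPL (φ : Formula) : Prop := φ.UsesOnly ∅

/-- Temporal depth. -/
def td : Formula → ℕ
  | top => 0
  | bot => 0
  | var _ => 0
  | neg φ => φ.td
  | and φ ψ => max φ.td ψ.td
  | or φ ψ => max φ.td ψ.td
  | un _ _ φ => φ.td + 1
  | bin _ φ ψ => max φ.td ψ.td + 1

/-- The set of subformulas of a formula, the formula itself included. -/
def SF : Formula → Set Formula
  | top => {top}
  | bot => {bot}
  | var p => {var p}
  | neg φ => insert (neg φ) φ.SF
  | and φ ψ => insert (and φ ψ) (φ.SF ∪ ψ.SF)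
  | or φ ψ => insert (or φ ψ) (φ.SF ∪ ψ.SF)
  | un q t φ => insert (un q t φ) φ.SF
  | bin q φ ψ => insert (bin q φ ψ) (φ.SF ∪ ψ.SF)

theorem self_mem_SF (φ : Formula) : φ ∈ φ.SF := by
  cases φ <;> simp [SF]

theorem finite_SF (φ : Formula) : φ.SF.Finite := by
  induction φ <;> simp_all [SF]

theorem SF_trans {χ ψ φ : Formula} (h : χ ∈ ψ.SF) (h' : ψ ∈ φ.SF) : χ ∈ φ.SF := by
  induction φ <;> simp only [SF, Set.mem_insert_iff, Set.mem_union, Set.mem_singleton_iff] at h' ⊢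
    <;> grind [SF]

end Formula

/-- The fragment of CTL formulas in negation normal form that use only operators from `T`. -/
def NNF (T : Set Operator) : Set Formula := {φ | φ.IsNNF ∧ φ.UsesOnly T}

/-! ### Kripke semantics -/

/-- Kripke structures: finitely many worlds and a total successor relation. -/
structure Kripke where
  W : Type
  fin : Finite W
  R : W → W → Prop
  total : ∀ w, ∃ w', R w w'
  V : W → Set ℕ

/-- The infinite paths of `K` that start in `w`. -/
def Kripke.paths (K : Kripke) (w : K.W) : Set (ℕ → K.W) :=
  {π | π 0 = w ∧ ∀ i, K.R (π i) (π (i + 1))}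

/-- Quantification over a set of paths. -/
def PathQ.Holds {α : Type} : PathQ → Set α → (α → Prop) → Prop
  | A, S, P => ∀ π ∈ S, P π
  | E, S, P => ∃ π ∈ S, P π

/-- A temporal operator on a path, for an argument that holds exactly at the worlds in `P`. -/
def TempOp.Holds {W : Type} : TempOp → (W → Prop) → (ℕ → W) → Prop
  | X, P, π => P (π 1)
  | F, P, π => ∃ i, P (π i)
  | G, P, π => ∀ i, P (π i)

/-- `K.Sat φ w` is `K, w ⊨ φ`. -/
def Kripke.Sat (K : Kripke) : Formula → K.W → Prop
  | .top, _ => True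
  | .bot, _ => False
  | .var p, w => p ∈ K.V w
  | .neg φ, w => ¬ K.Sat φ w
  | .and φ ψ, w => K.Sat φ w ∧ K.Sat ψ w
  | .or φ ψ, w => K.Sat φ w ∨ K.Sat ψ w
  | .un q t φ, w => q.Holds (K.paths w) (fun π => t.Holds (fun v => K.Sat φ v) π)
  | .bin q φ ψ, w => q.Holds (K.paths w)
      (fun π => ∃ i, (∀ j < i, K.Sat φ (π j)) ∧ K.Sat ψ (π i))

/-- Satisfiability of a CTL formula. -/
def Formula.Satisfiable (φ : Formula) : Prop := ∃ (K : Kripke) (w : K.W), K.Sat φ w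

/-! ### The vocabulary and the structures that encode formulas -/

/-- Argument positions of the Boolean connectives. -/
inductive ConnPos
  | and₁
  | and₂
  | or₁
  | or₂
  | not₁

/-- The argument of a formula at a position of a connective, if that connective is at the root. -/
def ConnPos.arg : ConnPos → Formula → Option Formula
  | and₁, .and φ _ => some φ
  | and₂, .and _ ψ => some ψ
  | or₁, .or φ _ => some φ
  | or₂, .or _ ψ => some ψ
  | not₁, .neg φ => some φ
  | _, _ => none

/-- The constant true or false. -/
def constFormula : Bool → Formula
  | true => .top
  | false => .bot

/-- The relation symbols, indexed by their arity. -/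
inductive TauRel : ℕ → Type
  | const (b : Bool) : TauRel 1
  | var : TauRel 1
  | repr : TauRel 1
  | reprPL : TauRel 1
  | reprUn (q : PathQ) (t : TempOp) : TauRel 1
  | reprBin (q : PathQ) : TauRel 1
  | conn (c : ConnPos) : TauRel 2
  | bodyUn (q : PathQ) (t : TempOp) : TauRel 2
  | bodyBin (q : PathQ) : TauRel 3

/-- The (relational, finite) vocabulary of the encoding structures. -/
def tau : FirstOrder.Language := ⟨fun _ => Empty, TauRel⟩

/-- The meaning of the relation symbols on a set of elements `x`, each of which represents the
formula `x.1`, in the encoding of `φ`. -/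
def TauRel.Interp (φ : Formula) {S : Set Formula} : {n : ℕ} → TauRel n → (Fin n → S) → Prop
  | _, const b, a => (a 0).1 = constFormula b
  | _, var, a => ∃ p, (a 0).1 = .var p
  | _, repr, a => (a 0).1 = φ
  | _, reprPL, a => (a 0).1.IsPL
  | _, reprUn q t, a => ∃ ψ, (a 0).1 = .un q t ψ
  | _, reprBin q, a => ∃ ψ χ, (a 0).1 = .bin q ψ χ
  | _, conn c, a => c.arg (a 1).1 = some (a 0).1
  | _, bodyUn q t, a => (a 1).1 = .un q t (a 0).1
  | _, bodyBin q, a => (a 2).1 = .bin q (a 0).1 (a 1).1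

/-- The universe of the structure `A_φ`: the subformulas of `φ`. -/
def Formula.Univ (φ : Formula) : Type := φ.SF

/-- The structure `A_φ`. -/
instance (φ : Formula) : tau.Structure φ.Univ where
  funMap := fun f => Empty.elim f
  RelMap := fun r a => TauRel.Interp φ (S := φ.SF) r a

open FirstOrder.Language.Structure in
/-- The structure on `A` encodes `φ`, where the element `x` represents the formula `ρ x`. Several
elements may represent the same subformula (as in the syntax tree of `φ`), except that `φ` and each
proposition have only one representative. -/
structure IsEncoding (φ : Formula) (A : Type) [tau.Structure A] (ρ : A → Formula) : Prop where
  mem_SF : ∀ x, ρ x ∈ φ.SF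
  surj : ∀ ψ ∈ φ.SF, ∃ x, ρ x = ψ
  root_unique : ∀ x y, ρ x = φ → ρ y = φ → x = y
  var_unique : ∀ p x y, ρ x = .var p → ρ y = .var p → x = y
  const_iff : ∀ b x, RelMap (L := tau) (TauRel.const b) ![x] ↔ ρ x = constFormula b
  var_iff : ∀ x, RelMap (L := tau) TauRel.var ![x] ↔ ∃ p, ρ x = .var p
  repr_iff : ∀ x, RelMap (L := tau) TauRel.repr ![x] ↔ ρ x = φ
  reprPL_iff : ∀ x, RelMap (L := tau) TauRel.reprPL ![x] ↔ (ρ x).IsPL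
  reprUn_iff : ∀ q t x, RelMap (L := tau) (TauRel.reprUn q t) ![x] ↔ ∃ ψ, ρ x = .un q t ψ
  reprBin_iff : ∀ q x, RelMap (L := tau) (TauRel.reprBin q) ![x] ↔ ∃ ψ χ, ρ x = .bin q ψ χ
  conn_sound : ∀ c x y, RelMap (L := tau) (TauRel.conn c) ![x, y] → c.arg (ρ y) = some (ρ x)
  conn_complete : ∀ c y ψ, c.arg (ρ y) = some ψ → ∃! x, RelMap (L := tau) (TauRel.conn c) ![x, y]
  bodyUn_sound : ∀ q t y x, RelMap (L := tau) (TauRel.bodyUn q t) ![y, x] → ρ x = .un q t (ρ y)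
  bodyUn_complete : ∀ q t x ψ, ρ x = .un q t ψ →
    ∃! y, RelMap (L := tau) (TauRel.bodyUn q t) ![y, x]
  bodyBin_sound : ∀ q y z x, RelMap (L := tau) (TauRel.bodyBin q) ![y, z, x] →
    ρ x = .bin q (ρ y) (ρ z)
  bodyBin_complete : ∀ q x ψ χ, ρ x = .bin q ψ χ →
    ∃! yz : A × A, RelMap (L := tau) (TauRel.bodyBin q) ![yz.1, yz.2, x]

theorem finite_univ (φ : Formula) : Finite φ.Univ := φ.finite_SF.to_subtype

theorem arg_mem_SF {c : ConnPos} {φ ψ : Formula} (h : c.arg φ = some ψ) : ψ ∈ φ.SF := by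
  cases c <;> cases φ <;> simp_all [ConnPos.arg, Formula.SF, Formula.self_mem_SF]

/-- The structure `A_φ` is an encoding of `φ` in which each subformula represents itself. -/
theorem isEncoding_univ (φ : Formula) : IsEncoding φ φ.Univ Subtype.val where
  mem_SF x := x.2
  surj ψ h := ⟨⟨ψ, h⟩, rfl⟩
  root_unique x y h h' := Subtype.ext (h.trans h'.symm)
  var_unique p x y h h' := Subtype.ext (h.trans h'.symm)
  const_iff _ _ := Iff.rfl
  var_iff _ := Iff.rfl
  repr_iff _ := Iff.rfl
  reprPL_iff _ := Iff.rfl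
  reprUn_iff _ _ _ := Iff.rfl
  reprBin_iff _ _ := Iff.rfl
  conn_sound _ _ _ h := h
  conn_complete c y ψ h := ⟨⟨ψ, Formula.SF_trans (arg_mem_SF h) y.2⟩, h, fun z hz =>
    Subtype.ext (Option.some.inj ((show c.arg y.1 = some z.1 from hz).symm.trans h))⟩
  bodyUn_sound _ _ _ _ h := h
  bodyUn_complete q t x ψ h := ⟨⟨ψ, Formula.SF_trans
      (by rw [h]; simp [Formula.SF, Formula.self_mem_SF]) x.2⟩, h, fun z hz =>
    Subtype.ext (by
      have := (show x.1 = .un q t z.1 from hz).symm.trans h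
      simpa using this)⟩
  bodyBin_sound _ _ _ _ h := h
  bodyBin_complete q x ψ χ h := by
    have h1 : ψ ∈ φ.SF := Formula.SF_trans (by rw [h]; simp [Formula.SF, Formula.self_mem_SF]) x.2
    have h2 : χ ∈ φ.SF := Formula.SF_trans (by rw [h]; simp [Formula.SF, Formula.self_mem_SF]) x.2
    refine ⟨(⟨ψ, h1⟩, ⟨χ, h2⟩), h, fun z hz => ?_⟩
    have := (show x.1 = .bin q z.1.1 z.2.1 from hz).symm.trans h
    simp only [Formula.bin.injEq, true_and] at this
    exact Prod.ext (Subtype.ext this.1) (Subtype.ext this.2)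

end CTL

/-! ### Monadic second-order logic -/

/-- Formulas of monadic second-order logic over a relational vocabulary `L`, with element variables
`x₀, x₁, …` and set variables `X₀, X₁, …`. -/
inductive MSO (L : FirstOrder.Language)
  | rel {n : ℕ} (r : L.Relations n) (x : Fin n → ℕ)
  | eq (x y : ℕ)
  | mem (x X : ℕ)
  | neg (θ : MSO L)
  | and (θ η : MSO L)
  | or (θ η : MSO L)
  | ex (x : ℕ) (θ : MSO L)
  | all (x : ℕ) (θ : MSO L)
  | exSet (X : ℕ) (θ : MSO L)
  | allSet (X : ℕ) (θ : MSO L)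

namespace MSO

variable {L : FirstOrder.Language}

/-- Satisfaction under an assignment `v` of the element variables and `V` of the set variables. -/
def Sat (A : Type) [L.Structure A] : MSO L → (ℕ → A) → (ℕ → Set A) → Prop
  | rel r x, v, _ => FirstOrder.Language.Structure.RelMap r (fun i => v (x i))
  | eq x y, v, _ => v x = v y
  | mem x X, v, V => v x ∈ V X
  | neg θ, v, V => ¬ θ.Sat A v V
  | and θ η, v, V => θ.Sat A v V ∧ η.Sat A v V
  | or θ η, v, V => θ.Sat A v V ∨ η.Sat A v V
  | ex x θ, v, V => ∃ a : A, θ.Sat A (Function.update v x a) V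
  | all x θ, v, V => ∀ a : A, θ.Sat A (Function.update v x a) V
  | exSet X θ, v, V => ∃ S : Set A, θ.Sat A v (Function.update V X S)
  | allSet X θ, v, V => ∀ S : Set A, θ.Sat A v (Function.update V X S)

/-- The free element variables. -/
def freeVars : MSO L → Set ℕ
  | rel _ x => Set.range x
  | eq x y => {x, y}
  | mem x _ => {x}
  | neg θ => θ.freeVars
  | and θ η => θ.freeVars ∪ η.freeVars
  | or θ η => θ.freeVars ∪ η.freeVars
  | ex x θ => θ.freeVars \ {x}
  | all x θ => θ.freeVars \ {x}
  | exSet _ θ => θ.freeVars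
  | allSet _ θ => θ.freeVars

/-- The free set variables. -/
def freeSetVars : MSO L → Set ℕ
  | rel _ _ => ∅
  | eq _ _ => ∅
  | mem _ X => {X}
  | neg θ => θ.freeSetVars
  | and θ η => θ.freeSetVars ∪ η.freeSetVars
  | or θ η => θ.freeSetVars ∪ η.freeSetVars
  | ex _ θ => θ.freeSetVars
  | all _ θ => θ.freeSetVars
  | exSet X θ => θ.freeSetVars \ {X}
  | allSet X θ => θ.freeSetVars \ {X}

/-- Sentences: formulas without free variables. -/
def IsSentence (θ : MSO L) : Prop := θ.freeVars = ∅ ∧ θ.freeSetVars = ∅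

/-- `θ.HoldsIn A` is `A ⊨ θ`; for a sentence the assignments do not matter. -/
def HoldsIn (θ : MSO L) (A : Type) [L.Structure A] : Prop := ∀ v V, θ.Sat A v V

end MSO

/-! ### Gödel numbers of MSO formulas over the vocabulary `tau`, used to say that a family of
formulas is computable -/

namespace CTL

def PathQ.code : PathQ → ℕ
  | A => 0
  | E => 1

def TempOp.code : TempOp → ℕ
  | X => 0
  | F => 1
  | G => 2

def ConnPos.code : ConnPos → ℕ
  | and₁ => 0
  | and₂ => 1
  | or₁ => 2
  | or₂ => 3
  | not₁ => 4

def TauRel.code : {n : ℕ} → TauRel n → ℕ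
  | _, const b => Nat.pair 0 b.toNat
  | _, var => Nat.pair 1 0
  | _, repr => Nat.pair 2 0
  | _, reprPL => Nat.pair 3 0
  | _, reprUn q t => Nat.pair 4 (Nat.pair q.code t.code)
  | _, reprBin q => Nat.pair 5 q.code
  | _, conn c => Nat.pair 6 c.code
  | _, bodyUn q t => Nat.pair 7 (Nat.pair q.code t.code)
  | _, bodyBin q => Nat.pair 8 q.code

/-- The Gödel number of an MSO formula. -/
def msoCode : MSO tau → ℕ
  | @MSO.rel _ n r x =>
      Nat.pair 0 (Nat.pair n (Nat.pair (TauRel.code r) (Encodable.encode (List.ofFn x))))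
  | .eq x y => Nat.pair 1 (Nat.pair x y)
  | .mem x X => Nat.pair 2 (Nat.pair x X)
  | .neg θ => Nat.pair 3 (msoCode θ)
  | .and θ η => Nat.pair 4 (Nat.pair (msoCode θ) (msoCode η))
  | .or θ η => Nat.pair 5 (Nat.pair (msoCode θ) (msoCode η))
  | .ex x θ => Nat.pair 6 (Nat.pair x (msoCode θ))
  | .all x θ => Nat.pair 7 (Nat.pair x (msoCode θ))
  | .exSet X θ => Nat.pair 8 (Nat.pair X (msoCode θ))
  | .allSet X θ => Nat.pair 9 (Nat.pair X (msoCode θ))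

theorem TauRel.code_injective {n : ℕ} {r s : TauRel n} (h : r.code = s.code) : r = s := by
  have hq : ∀ q q' : PathQ, q.code = q'.code → q = q' := by
    intro q q'; cases q <;> cases q' <;> simp [PathQ.code]
  have ht : ∀ t t' : TempOp, t.code = t'.code → t = t' := by
    intro t t'; cases t <;> cases t' <;> simp [TempOp.code]
  have hc : ∀ c c' : ConnPos, c.code = c'.code → c = c' := by
    intro c c'; cases c <;> cases c' <;> simp [ConnPos.code]
  have hb : ∀ b b' : Bool, b.toNat = b'.toNat → b = b' := by decide
  cases r <;> cases s <;> simp [TauRel.code, Nat.pair_eq_pair] at h ⊢ <;> grind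

theorem msoCode_injective : Function.Injective msoCode := by
  intro θ
  induction θ with
  | rel r x =>
    intro η h
    cases η <;> simp [msoCode, Nat.pair_eq_pair] at h
    obtain ⟨rfl, hr, hx⟩ := h
    rw [TauRel.code_injective hr, List.ofFn_injective hx]
  | _ =>
    intro η h
    cases η <;> simp [msoCode, Nat.pair_eq_pair] at h ⊢ <;> grind

end CTL

/-!
Guess at each world the set `T` of elements whose formulas are true there. Such a set respects the
Boolean connectives (it is a Hintikka set), and each element `e` has a successor world whose set `U`
contains the bodies of all `AX`-elements of `T`, contains no body of an `EX`-element outside `T`,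
and witnesses the truth value of `e` itself. If this unfolding can be continued for `d` steps then,
conversely, gluing models of the sets `U` below a new root makes exactly the elements of `T` of
temporal depth at most `d` true at the root. Since `d` is fixed, the unfolding is described by an
MSO formula built by recursion on `d`.
-/

namespace CTL

open FirstOrder.Language.Structure

namespace Kripke

theorem exists_path (K : Kripke) {w v : K.W} (h : K.R w v) : ∃ π ∈ K.paths w, π 1 = v := by
  choose next hnext using K.total
  refine ⟨fun n => Nat.casesOn n w (fun n => next^[n] v), ⟨rfl, fun i => ?_⟩, rfl⟩
  cases i with
  | zero => exact h
  | succ i =>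
    simp only [Function.iterate_succ_apply']
    exact hnext _

theorem sat_AX {K : Kripke} {φ : Formula} {w : K.W} :
    K.Sat (.un .A .X φ) w ↔ ∀ v, K.R w v → K.Sat φ v := by
  constructor
  · intro h v hv
    obtain ⟨π, hπ, rfl⟩ := K.exists_path hv
    exact h π hπ
  · intro h π hπ
    exact h _ (hπ.1 ▸ hπ.2 0)

theorem sat_EX {K : Kripke} {φ : Formula} {w : K.W} :
    K.Sat (.un .E .X φ) w ↔ ∃ v, K.R w v ∧ K.Sat φ v := by
  constructor
  · rintro ⟨π, hπ, h⟩
    exact ⟨π 1, hπ.1 ▸ hπ.2 0, h⟩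
  · rintro ⟨v, hv, h⟩
    obtain ⟨π, hπ, rfl⟩ := K.exists_path hv
    exact ⟨π, hπ, h⟩

theorem exists_successor_witness (K : Kripke) (w : K.W) (χ : Formula) :
    ∃ v, K.R w v ∧ (∀ ψ, χ = .un .A .X ψ → K.Sat ψ v → K.Sat χ w) ∧
      ∀ ψ, χ = .un .E .X ψ → K.Sat χ w → K.Sat ψ v := by
  by_cases hA : ∃ ψ, χ = .un .A .X ψ ∧ ¬ K.Sat χ w
  · obtain ⟨ψ, rfl, h⟩ := hA
    obtain ⟨v, hv, hψ⟩ : ∃ v, K.R w v ∧ ¬ K.Sat ψ v := by simpa [sat_AX] using h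
    exact ⟨v, hv, by rintro _ ⟨⟩ h; exact absurd h hψ, by rintro _ ⟨⟩⟩
  by_cases hE : ∃ ψ, χ = .un .E .X ψ ∧ K.Sat χ w
  · obtain ⟨ψ, rfl, h⟩ := hE
    obtain ⟨v, hv, hψ⟩ := sat_EX.1 h
    exact ⟨v, hv, by rintro _ ⟨⟩, by rintro _ ⟨⟩ -; exact hψ⟩
  · obtain ⟨v, hv⟩ := K.total w
    exact ⟨v, hv, fun ψ hψ _ => by_contra fun h => hA ⟨ψ, hψ, h⟩,
      fun ψ hψ h => absurd ⟨ψ, hψ, h⟩ hE⟩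

/-- Bounded morphisms (p-morphisms) of Kripke structures, the maps that preserve the truth of all
CTL formulas. -/
structure IsBoundedMorphism {K K' : Kripke} (f : K.W → K'.W) : Prop where
  rel_iff : ∀ w v, K'.R (f w) v ↔ ∃ u, K.R w u ∧ f u = v
  val_eq : ∀ w, K'.V (f w) = K.V w

theorem IsBoundedMorphism.paths_eq {K K' : Kripke} {f : K.W → K'.W} (hf : IsBoundedMorphism f)
    (w : K.W) : K'.paths (f w) = (f ∘ ·) '' K.paths w := by
  apply subset_antisymm
  · intro π' hπ'
    have exists_next (n : ℕ) (u : {u // f u = π' n}) :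
        ∃ v : {v // f v = π' (n + 1)}, K.R u v := by
      obtain ⟨v, hv, hvπ⟩ := (hf.rel_iff u _).1 (u.2 ▸ hπ'.2 n)
      exact ⟨⟨v, hvπ⟩, hv⟩
    choose next hnext using exists_next
    let lift : ∀ n, {u // f u = π' n} := Nat.rec ⟨w, hπ'.1.symm⟩ next
    exact ⟨fun n => (lift n).1, ⟨rfl, fun n => hnext n (lift n)⟩, funext fun n => (lift n).2⟩
  · rintro _ ⟨π, ⟨rfl, hπ⟩, rfl⟩
    exact ⟨rfl, fun i => (hf.rel_iff _ _).2 ⟨_, hπ i, rfl⟩⟩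

theorem IsBoundedMorphism.sat_iff {K K' : Kripke} {f : K.W → K'.W} (hf : IsBoundedMorphism f)
    {φ : Formula} {w : K.W} : K'.Sat φ (f w) ↔ K.Sat φ w := by
  induction φ generalizing w with
  | top => rfl
  | bot => rfl
  | var p => simp only [Sat, hf.val_eq]
  | neg φ ih => simp only [Sat, ih]
  | and φ ψ ihφ ihψ => simp only [Sat, ihφ, ihψ]
  | or φ ψ ihφ ihψ => simp only [Sat, ihφ, ihψ]
  | un q t φ ih =>
    cases q <;> cases t <;>
      simp only [Sat, PathQ.Holds, TempOp.Holds, hf.paths_eq, Set.forall_mem_image,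
        Set.exists_mem_image, Function.comp_apply, ih]
  | bin q φ ψ ihφ ihψ =>
    cases q <;>
      simp only [Sat, PathQ.Holds, hf.paths_eq, Set.forall_mem_image, Set.exists_mem_image,
        Function.comp_apply, ihφ, ihψ]

/-- The Kripke structure with one reflexive world, in which exactly the propositions in `P` hold. -/
def point (P : Set ℕ) : Kripke where
  W := Unit
  fin := inferInstance
  R _ _ := True
  total _ := ⟨(), trivial⟩
  V _ := P

section Join

variable {ι : Type} [Finite ι] [Nonempty ι]

/-- The disjoint union of the structures `K i`, together with a new root `none` that satisfies the
propositions in `P` and has the worlds `w i` as its successors. -/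
def join (K : ι → Kripke) (w : ∀ i, (K i).W) (P : Set ℕ) : Kripke where
  W := Option (Σ i, (K i).W)
  fin := by
    have := fun i => (K i).fin
    infer_instance
  R
    | none, v => ∃ i, v = some ⟨i, w i⟩
    | some u, v => ∃ u', (K u.1).R u.2 u' ∧ some ⟨u.1, u'⟩ = v
  total
    | none => ⟨_, Classical.arbitrary ι, rfl⟩
    | some u => by
      obtain ⟨u', h⟩ := (K u.1).total u.2
      exact ⟨_, u', h, rfl⟩
  V
    | none => P
    | some u => (K u.1).V u.2

variable {K : ι → Kripke} {w : ∀ i, (K i).W} {P : Set ℕ} {φ : Formula}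

theorem sat_join_some {i : ι} {u : (K i).W} :
    (join K w P).Sat φ (some ⟨i, u⟩) ↔ (K i).Sat φ u :=
  IsBoundedMorphism.sat_iff (K' := join K w P) (f := fun u => some ⟨i, u⟩)
    ⟨fun _ _ => Iff.rfl, fun _ => rfl⟩

theorem sat_AX_join_root :
    (join K w P).Sat (.un .A .X φ) none ↔ ∀ i, (K i).Sat φ (w i) :=
  sat_AX.trans ⟨fun h i => sat_join_some.1 (h _ ⟨i, rfl⟩),
    by rintro h _ ⟨i, rfl⟩; exact sat_join_some.2 (h i)⟩

theorem sat_EX_join_root :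
    (join K w P).Sat (.un .E .X φ) none ↔ ∃ i, (K i).Sat φ (w i) :=
  sat_EX.trans ⟨by rintro ⟨_, ⟨i, rfl⟩, h⟩; exact ⟨i, sat_join_some.1 h⟩,
    fun ⟨i, h⟩ => ⟨_, ⟨i, rfl⟩, sat_join_some.2 h⟩⟩

end Join

end Kripke

namespace Formula.UsesOnly

theorem of_mem_SF {T : Set Operator} {φ ψ : Formula} (h : φ.UsesOnly T) (hψ : ψ ∈ φ.SF) :
    ψ.UsesOnly T := by
  induction φ <;> simp only [SF, Set.mem_insert_iff, Set.mem_union, Set.mem_singleton_iff] at hψ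
    <;> grind [UsesOnly]

theorem eq_X {q : PathQ} {t : TempOp} {φ : Formula}
    (h : (Formula.un q t φ).UsesOnly {opAX, opEX}) : t = .X := by
  have : Operator.un q t = opAX ∨ Operator.un q t = opEX := h.1
  simp only [opAX, opEX, Operator.un.injEq] at this
  tauto

theorem not_bin {q : PathQ} {φ ψ : Formula} :
    ¬ (Formula.bin q φ ψ).UsesOnly {opAX, opEX} := by
  simp [UsesOnly, opAX, opEX]

end Formula.UsesOnly

namespace ConnPos

variable {φ ψ χ : Formula}

theorem eq_neg_of_arg (h : not₁.arg φ = some ψ) : φ = .neg ψ := by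
  cases φ <;> simp_all [arg]

theorem eq_and_of_arg (h₁ : and₁.arg φ = some ψ) (h₂ : and₂.arg φ = some χ) :
    φ = .and ψ χ := by
  cases φ <;> simp_all [arg]

theorem eq_or_of_arg (h₁ : or₁.arg φ = some ψ) (h₂ : or₂.arg φ = some χ) :
    φ = .or ψ χ := by
  cases φ <;> simp_all [arg]

end ConnPos

section Unfolding

variable {A : Type} [tau.Structure A]

/-- Hintikka sets: the Boolean connectives and constants behave as if exactly the elements of `T`
represented true formulas. -/
structure IsHintikka (T : Set A) : Prop where
  top : ∀ x, RelMap (L := tau) (TauRel.const true) ![x] → x ∈ T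
  bot : ∀ x, RelMap (L := tau) (TauRel.const false) ![x] → x ∉ T
  neg : ∀ x y, RelMap (L := tau) (TauRel.conn .not₁) ![y, x] → (x ∈ T ↔ y ∉ T)
  and : ∀ x y z, RelMap (L := tau) (TauRel.conn .and₁) ![y, x] →
    RelMap (L := tau) (TauRel.conn .and₂) ![z, x] → (x ∈ T ↔ y ∈ T ∧ z ∈ T)
  or : ∀ x y z, RelMap (L := tau) (TauRel.conn .or₁) ![y, x] →
    RelMap (L := tau) (TauRel.conn .or₂) ![z, x] → (x ∈ T ↔ y ∈ T ∨ z ∈ T)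

/-- If `T` is the set of true elements at a world, then `U` may be the set of true elements at a
successor of that world, chosen so that it witnesses the truth value of `e` in case `e` is an
`EX`-element of `T` or an `AX`-element outside `T`. -/
structure IsWitnessingSuccessor (T U : Set A) (e : A) : Prop where
  mem_of_AX : ∀ x y, RelMap (L := tau) (TauRel.bodyUn .A .X) ![y, x] → x ∈ T → y ∈ U
  EX_mem : ∀ x y, RelMap (L := tau) (TauRel.bodyUn .E .X) ![y, x] → y ∈ U → x ∈ T
  AX_mem : ∀ y, RelMap (L := tau) (TauRel.bodyUn .A .X) ![y, e] → y ∈ U → e ∈ T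
  mem_of_EX : ∀ y, RelMap (L := tau) (TauRel.bodyUn .E .X) ![y, e] → e ∈ T → y ∈ U

/-- `T` is the root of a tree of Hintikka sets of height `d` in which every node that is not a leaf
has a witnessing successor for each element. -/
def HasUnfolding : ℕ → Set A → Prop
  | 0, T => IsHintikka T
  | d + 1, T => IsHintikka T ∧ ∀ e, ∃ U, IsWitnessingSuccessor T U e ∧ HasUnfolding d U

namespace IsEncoding

variable {φ : Formula} {ρ : A → Formula} (hρ : IsEncoding φ A ρ)
include hρ

theorem exists_arg {c : ConnPos} {x : A} {ψ : Formula} (h : c.arg (ρ x) = some ψ) :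
    ∃ y, RelMap (L := tau) (TauRel.conn c) ![y, x] ∧ ρ y = ψ := by
  obtain ⟨y, hy, -⟩ := hρ.conn_complete c x ψ h
  exact ⟨y, hy, Option.some.inj ((hρ.conn_sound c y x hy).symm.trans h)⟩

theorem exists_body {q : PathQ} {t : TempOp} {x : A} {ψ : Formula} (h : ρ x = .un q t ψ) :
    ∃ y, RelMap (L := tau) (TauRel.bodyUn q t) ![y, x] ∧ ρ y = ψ := by
  obtain ⟨y, hy, -⟩ := hρ.bodyUn_complete q t x ψ h
  exact ⟨y, hy, (Formula.un.inj ((hρ.bodyUn_sound q t y x hy).symm.trans h)).2.2⟩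

theorem isHintikka_setOf_sat (K : Kripke) (w : K.W) : IsHintikka {x | K.Sat (ρ x) w} where
  top x h := by
    rw [Set.mem_ofPred_eq, (hρ.const_iff _ _).1 h]
    trivial
  bot x h := by
    rw [Set.mem_ofPred_eq, (hρ.const_iff _ _).1 h]
    exact id
  neg x y h := by
    rw [Set.mem_ofPred_eq, ConnPos.eq_neg_of_arg (hρ.conn_sound _ _ _ h)]
    rfl
  and x y z hy hz := by
    rw [Set.mem_ofPred_eq, ConnPos.eq_and_of_arg (hρ.conn_sound _ _ _ hy) (hρ.conn_sound _ _ _ hz)]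
    rfl
  or x y z hy hz := by
    rw [Set.mem_ofPred_eq, ConnPos.eq_or_of_arg (hρ.conn_sound _ _ _ hy) (hρ.conn_sound _ _ _ hz)]
    rfl

theorem exists_isWitnessingSuccessor_setOf_sat (K : Kripke) (w : K.W) (e : A) :
    ∃ v, IsWitnessingSuccessor {x | K.Sat (ρ x) w} {x | K.Sat (ρ x) v} e := by
  obtain ⟨v, hv, hA, hE⟩ := K.exists_successor_witness w (ρ e)
  refine ⟨v, fun x y h hx => ?_, fun x y h hy => ?_,
    fun y h => hA _ (hρ.bodyUn_sound _ _ _ _ h), fun y h => hE _ (hρ.bodyUn_sound _ _ _ _ h)⟩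
  · rw [Set.mem_ofPred_eq, hρ.bodyUn_sound _ _ _ _ h] at hx
    exact Kripke.sat_AX.1 hx v hv
  · rw [Set.mem_ofPred_eq, hρ.bodyUn_sound _ _ _ _ h]
    exact Kripke.sat_EX.2 ⟨v, hv, hy⟩

theorem hasUnfolding_setOf_sat (K : Kripke) (w : K.W) (d : ℕ) :
    HasUnfolding d {x | K.Sat (ρ x) w} := by
  induction d generalizing w with
  | zero => exact hρ.isHintikka_setOf_sat K w
  | succ d ih =>
    refine ⟨hρ.isHintikka_setOf_sat K w, fun e => ?_⟩
    obtain ⟨v, hv⟩ := hρ.exists_isWitnessingSuccessor_setOf_sat K w e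
    exact ⟨_, hv, ih v⟩

theorem mem_iff_sat_of_modal (hφ : φ.UsesOnly {opAX, opEX}) {T : Set A} (hT : IsHintikka T)
    {K : Kripke} {w : K.W} {d : ℕ} (hV : K.V w = {p | ∃ x ∈ T, ρ x = .var p})
    (hmodal : ∀ q x ψ, ρ x = .un q .X ψ → (ρ x).td ≤ d → (x ∈ T ↔ K.Sat (ρ x) w))
    {x : A} (hx : (ρ x).td ≤ d) : x ∈ T ↔ K.Sat (ρ x) w := by
  induction hψ : ρ x generalizing x with
  | top => exact iff_of_true (hT.top x ((hρ.const_iff _ _).2 hψ)) trivial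
  | bot => exact iff_of_false (hT.bot x ((hρ.const_iff _ _).2 hψ)) id
  | var p =>
    rw [Kripke.Sat, hV]
    exact ⟨fun h => ⟨x, h, hψ⟩, fun ⟨y, hy, hyp⟩ => hρ.var_unique p y x hyp hψ ▸ hy⟩
  | neg ψ ih =>
    obtain ⟨y, hy, rfl⟩ := hρ.exists_arg (c := .not₁) (congrArg _ hψ)
    rw [hψ, Formula.td] at hx
    rw [hT.neg x y hy, ih hx rfl, Kripke.Sat]
  | and ψ χ ihψ ihχ =>
    obtain ⟨y, hy, rfl⟩ := hρ.exists_arg (c := .and₁) (congrArg _ hψ)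
    obtain ⟨z, hz, rfl⟩ := hρ.exists_arg (c := .and₂) (congrArg _ hψ)
    rw [hψ, Formula.td, max_le_iff] at hx
    rw [hT.and x y z hy hz, ihψ hx.1 rfl, ihχ hx.2 rfl, Kripke.Sat]
  | or ψ χ ihψ ihχ =>
    obtain ⟨y, hy, rfl⟩ := hρ.exists_arg (c := .or₁) (congrArg _ hψ)
    obtain ⟨z, hz, rfl⟩ := hρ.exists_arg (c := .or₂) (congrArg _ hψ)
    rw [hψ, Formula.td, max_le_iff] at hx
    rw [hT.or x y z hy hz, ihψ hx.1 rfl, ihχ hx.2 rfl, Kripke.Sat]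
  | un q t ψ =>
    obtain rfl : t = .X := (hψ ▸ hφ.of_mem_SF (hρ.mem_SF x)).eq_X
    exact hψ ▸ hmodal q x ψ hψ hx
  | bin q ψ χ => exact absurd (hψ ▸ hφ.of_mem_SF (hρ.mem_SF x)) Formula.UsesOnly.not_bin

theorem exists_finite_representatives (T : Set A) :
    ∃ s : Set A, s.Finite ∧ ∀ x, ∃ y ∈ s, ρ y = ρ x ∧ (y ∈ T ↔ x ∈ T) := by
  let f : A → Formula × Prop := fun x => (ρ x, x ∈ T)
  have hf : (Set.range f).Finite :=
    (φ.finite_SF.prod Set.finite_univ).subset <|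
      Set.range_subset_iff.2 fun x => ⟨hρ.mem_SF x, trivial⟩
  obtain ⟨s, hs, hinj⟩ := Set.exists_image_eq_and_injOn Set.univ f
  rw [Set.image_univ] at hs
  refine ⟨s, .of_finite_image (hs ▸ hf) hinj, fun x => ?_⟩
  obtain ⟨y, hy, hyx⟩ : f x ∈ f '' s := hs ▸ Set.mem_range_self x
  exact ⟨y, hy, congrArg Prod.fst hyx, (congrArg Prod.snd hyx).to_iff⟩

theorem exists_model_of_hasUnfolding (hφ : φ.UsesOnly {opAX, opEX}) {d : ℕ} {T : Set A}
    (h : HasUnfolding d T) :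
    ∃ (K : Kripke) (w : K.W), ∀ x, (ρ x).td ≤ d → (x ∈ T ↔ K.Sat (ρ x) w) := by
  induction d generalizing T with
  | zero =>
    refine ⟨Kripke.point {p | ∃ x ∈ T, ρ x = .var p}, (), fun x =>
      hρ.mem_iff_sat_of_modal hφ h rfl fun q x ψ hψ hx => ?_⟩
    simp [hψ, Formula.td] at hx
  | succ d ih =>
    obtain ⟨hT, hsucc⟩ := h
    choose U hU hUd using hsucc
    choose K w hK using fun e => ih (hUd e)
    obtain ⟨s, hs, hrep⟩ := hρ.exists_finite_representatives T
    have : Finite s := hs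
    have : Nonempty s := by
      obtain ⟨x, -⟩ := hρ.surj φ φ.self_mem_SF
      obtain ⟨y, hy, -⟩ := hrep x
      exact ⟨y, hy⟩
    refine ⟨.join (fun e : s => K e) (fun e => w e) {p | ∃ x ∈ T, ρ x = .var p}, none, fun x =>
      hρ.mem_iff_sat_of_modal hφ hT rfl fun q x ψ hψ hx => ?_⟩
    obtain ⟨y, hy, rfl⟩ := hρ.exists_body hψ
    obtain ⟨e, he, hex, heT⟩ := hrep x
    obtain ⟨z, hz, hzy⟩ := hρ.exists_body (hex.trans hψ)
    have hyd : (ρ y).td ≤ d := by simpa [hψ, Formula.td] using hx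
    have hKz : z ∈ U e ↔ (K e).Sat (ρ y) (w e) := hzy ▸ hK e z (hzy ▸ hyd)
    rw [hψ]
    cases q with
    | A =>
      rw [Kripke.sat_AX_join_root]
      exact ⟨fun hxT i => (hK i y hyd).1 ((hU i).mem_of_AX x y hy hxT),
        fun hs => heT.1 ((hU e).AX_mem z hz (hKz.2 (hs ⟨e, he⟩)))⟩
    | E =>
      rw [Kripke.sat_EX_join_root]
      exact ⟨fun hxT => ⟨⟨e, he⟩, hKz.1 ((hU e).mem_of_EX z hz (heT.2 hxT))⟩,
        fun ⟨i, hi⟩ => (hU i).EX_mem x y hy ((hK i y hyd).2 hi)⟩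

theorem satisfiable_iff_exists_hasUnfolding (hφ : φ.UsesOnly {opAX, opEX}) :
    φ.Satisfiable ↔ ∃ T : Set A, (∃ x, RelMap (L := tau) TauRel.repr ![x] ∧ x ∈ T) ∧
      HasUnfolding φ.td T := by
  constructor
  · rintro ⟨K, w, h⟩
    obtain ⟨x, hx⟩ := hρ.surj φ φ.self_mem_SF
    refine ⟨{x | K.Sat (ρ x) w}, ⟨x, (hρ.repr_iff x).2 hx, ?_⟩, hρ.hasUnfolding_setOf_sat K w _⟩
    rwa [Set.mem_ofPred_eq, hx]
  · rintro ⟨T, ⟨x, hx, hxT⟩, hT⟩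
    obtain rfl := (hρ.repr_iff x).1 hx
    obtain ⟨K, w, hK⟩ := hρ.exists_model_of_hasUnfolding hφ hT
    exact ⟨K, w, (hK x le_rfl).1 hxT⟩

end IsEncoding

end Unfolding

end CTL

namespace MSO

variable {L : FirstOrder.Language}

/-- The implication `θ → η`, which `MSO` lacks as a primitive. -/
def imp (θ η : MSO L) : MSO L := .or (.neg θ) η

/-- The equivalence `θ ↔ η`, which `MSO` lacks as a primitive. -/
def iff (θ η : MSO L) : MSO L := .and (imp θ η) (imp η θ)

variable {A : Type} [L.Structure A] {v : ℕ → A} {V : ℕ → Set A}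

theorem sat_imp {θ η : MSO L} : (imp θ η).Sat A v V ↔ (θ.Sat A v V → η.Sat A v V) := by
  simp only [imp, Sat, imp_iff_not_or]

theorem sat_iff {θ η : MSO L} : (iff θ η).Sat A v V ↔ (θ.Sat A v V ↔ η.Sat A v V) := by
  simp only [iff, Sat, sat_imp, iff_def]

end MSO

namespace CTL

open FirstOrder.Language.Structure
open MSO (imp iff)

/-- The atomic formula `r(x)`. -/
def rel₁ (r : TauRel 1) (x : ℕ) : MSO tau := .rel (L := tau) r ![x]

/-- The atomic formula `r(x, y)`. -/
def rel₂ (r : TauRel 2) (x y : ℕ) : MSO tau := .rel (L := tau) r ![x, y]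

/-- The MSO formula expressing that `X₀` is a Hintikka set. -/
def hintikkaFormula : MSO tau :=
  .and (.all 0 (imp (rel₁ (.const true) 0) (.mem 0 0))) <|
  .and (.all 0 (imp (rel₁ (.const false) 0) (.neg (.mem 0 0)))) <|
  .and (.all 0 (.all 1 (imp (rel₂ (.conn .not₁) 1 0)
    (iff (.mem 0 0) (.neg (.mem 1 0)))))) <|
  .and (.all 0 (.all 1 (.all 2 (imp (rel₂ (.conn .and₁) 1 0)
    (imp (rel₂ (.conn .and₂) 2 0)
      (iff (.mem 0 0) (.and (.mem 1 0) (.mem 2 0)))))))) <|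
  .all 0 (.all 1 (.all 2 (imp (rel₂ (.conn .or₁) 1 0)
    (imp (rel₂ (.conn .or₂) 2 0)
      (iff (.mem 0 0) (.or (.mem 1 0) (.mem 2 0)))))))

/-- The MSO formula expressing that `X₀` is a witnessing successor of `X₁` for `x₀`. -/
def witnessingSuccessorFormula : MSO tau :=
  .and (.all 1 (.all 2 (imp (rel₂ (.bodyUn .A .X) 2 1)
    (imp (.mem 1 1) (.mem 2 0))))) <|
  .and (.all 1 (.all 2 (imp (rel₂ (.bodyUn .E .X) 2 1)
    (imp (.mem 2 0) (.mem 1 1))))) <|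
  .and (.all 2 (imp (rel₂ (.bodyUn .A .X) 2 0) (imp (.mem 2 0) (.mem 0 1)))) <|
  .all 2 (imp (rel₂ (.bodyUn .E .X) 2 0) (imp (.mem 0 1) (.mem 2 0)))

/-- The MSO formula expressing that `X₀` has an unfolding of the given depth. The step copies `X₀`
to `X₁` so that `X₀` can be requantified; the code of the step is then a fixed function of the code
of its recursive part. -/
def unfoldingFormula : ℕ → MSO tau
  | 0 => hintikkaFormula
  | d + 1 => .and hintikkaFormula <| .exSet 1 <| .and (.all 0 (iff (.mem 0 1) (.mem 0 0))) <|
      .all 0 (.exSet 0 (.and witnessingSuccessorFormula (unfoldingFormula d)))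

/-- The MSO sentence `θ_d` expressing that some set with an unfolding of depth `d` contains the
element representing the whole formula. -/
def satSentence (d : ℕ) : MSO tau :=
  .exSet 0 (.and (.ex 0 (.and (rel₁ .repr 0) (.mem 0 0))) (unfoldingFormula d))

section Sat

variable {A : Type} [tau.Structure A] {v : ℕ → A} {V : ℕ → Set A}

theorem sat_rel₁ {r : TauRel 1} {x : ℕ} :
    (rel₁ r x).Sat A v V ↔ RelMap (L := tau) r ![v x] := by
  have : (fun i => v (![x] i)) = ![v x] := by ext i; fin_cases i; rfl
  simp only [rel₁, MSO.Sat, this]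

theorem sat_rel₂ {r : TauRel 2} {x y : ℕ} :
    (rel₂ r x y).Sat A v V ↔ RelMap (L := tau) r ![v x, v y] := by
  have : (fun i => v (![x, y] i)) = ![v x, v y] := by ext i; fin_cases i <;> rfl
  simp only [rel₂, MSO.Sat, this]

theorem sat_hintikkaFormula : hintikkaFormula.Sat A v V ↔ IsHintikka (V 0) := by
  simp only [hintikkaFormula, MSO.Sat, MSO.sat_imp, MSO.sat_iff, sat_rel₁, sat_rel₂,
    Function.update_self, ne_eq, zero_ne_one, OfNat.zero_ne_ofNat, OfNat.one_ne_ofNat,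
    not_false_eq_true, Function.update_of_ne]
  exact ⟨fun ⟨top, bot, neg, and, or⟩ => ⟨top, bot, neg, and, or⟩,
    fun h => ⟨h.top, h.bot, h.neg, h.and, h.or⟩⟩

theorem sat_witnessingSuccessorFormula : witnessingSuccessorFormula.Sat A v V ↔
    IsWitnessingSuccessor (V 1) (V 0) (v 0) := by
  simp only [witnessingSuccessorFormula, MSO.Sat, MSO.sat_imp, sat_rel₂, Function.update_self,
    ne_eq, OfNat.zero_ne_ofNat, OfNat.one_ne_ofNat, not_false_eq_true, Function.update_of_ne]
  exact ⟨fun ⟨mem_of_AX, EX_mem, AX_mem, mem_of_EX⟩ => ⟨mem_of_AX, EX_mem, AX_mem, mem_of_EX⟩,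
    fun h => ⟨h.mem_of_AX, h.EX_mem, h.AX_mem, h.mem_of_EX⟩⟩

theorem sat_unfoldingFormula {d : ℕ} :
    (unfoldingFormula d).Sat A v V ↔ HasUnfolding d (V 0) := by
  induction d generalizing v V with
  | zero => exact sat_hintikkaFormula
  | succ d ih =>
    simp only [unfoldingFormula, MSO.Sat, MSO.sat_iff, sat_hintikkaFormula,
      sat_witnessingSuccessorFormula, ih, HasUnfolding, Function.update_self, ne_eq, zero_ne_one,
      one_ne_zero, not_false_eq_true, Function.update_of_ne, ← Set.ext_iff, exists_eq_left]

theorem sat_satSentence {d : ℕ} : (satSentence d).Sat A v V ↔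
    ∃ T : Set A, (∃ x, RelMap (L := tau) TauRel.repr ![x] ∧ x ∈ T) ∧ HasUnfolding d T := by
  simp only [satSentence, MSO.Sat, sat_rel₁, sat_unfoldingFormula, Function.update_self]

theorem IsEncoding.satisfiable_iff_holdsIn {φ : Formula} {ρ : A → Formula}
    (hρ : IsEncoding φ A ρ) (hφ : φ.UsesOnly {opAX, opEX}) :
    φ.Satisfiable ↔ (satSentence φ.td).HoldsIn A := by
  obtain ⟨x, -⟩ := hρ.surj φ φ.self_mem_SF
  have : Nonempty A := ⟨x⟩
  simp only [MSO.HoldsIn, sat_satSentence, hρ.satisfiable_iff_exists_hasUnfolding hφ,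
    forall_const]

end Sat

theorem freeVars_unfoldingFormula (d : ℕ) : (unfoldingFormula d).freeVars = ∅ := by
  induction d with
  | zero =>
    ext n
    simp [unfoldingFormula, hintikkaFormula, imp, iff, rel₁, rel₂, MSO.freeVars]
  | succ d ih =>
    ext n
    simp [unfoldingFormula, hintikkaFormula, witnessingSuccessorFormula, imp, iff, rel₁, rel₂,
      MSO.freeVars, ih]

theorem freeSetVars_hintikkaFormula : hintikkaFormula.freeSetVars = {0} := by
  simp [hintikkaFormula, imp, iff, rel₁, rel₂, MSO.freeSetVars]

theorem freeSetVars_witnessingSuccessorFormula :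
    witnessingSuccessorFormula.freeSetVars = {0, 1} := by
  ext n
  simp [witnessingSuccessorFormula, imp, rel₂, MSO.freeSetVars, or_comm]

theorem freeSetVars_unfoldingFormula (d : ℕ) : (unfoldingFormula d).freeSetVars = {0} := by
  induction d with
  | zero => exact freeSetVars_hintikkaFormula
  | succ d ih =>
    ext n
    simp only [unfoldingFormula, imp, iff, MSO.freeSetVars, freeSetVars_hintikkaFormula,
      freeSetVars_witnessingSuccessorFormula, ih, Set.mem_union, Set.mem_sdiff,
      Set.mem_insert_iff, Set.mem_singleton_iff]
    lia

theorem isSentence_satSentence (d : ℕ) : (satSentence d).IsSentence := by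
  constructor
  · simp [satSentence, rel₁, MSO.freeVars, freeVars_unfoldingFormula]
  · simp [satSentence, rel₁, MSO.freeSetVars, freeSetVars_unfoldingFormula]

theorem primrec_pair_const {α : Type*} [Primcodable α] (n : ℕ) {f : α → ℕ} (hf : Primrec f) :
    Primrec fun a => Nat.pair n (f a) :=
  Primrec₂.natPair.comp (Primrec.const n) hf

theorem primrec_msoCode_unfoldingFormula : Primrec fun d => msoCode (unfoldingFormula d) := by
  -- `msoCode` tags `and`, `all` and `exSet` by 4, 7 and 8.
  let stepCode (c : ℕ) : ℕ :=
    Nat.pair 4 <| Nat.pair (msoCode hintikkaFormula) <| Nat.pair 8 <| Nat.pair 1 <| Nat.pair 4 <|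
      Nat.pair (msoCode (.all 0 (iff (.mem 0 1) (.mem 0 0)))) <| Nat.pair 7 <| Nat.pair 0 <|
        Nat.pair 8 <| Nat.pair 0 <| Nat.pair 4 <| Nat.pair (msoCode witnessingSuccessorFormula) c
  have hstep : Primrec stepCode := by
    iterate 12 apply primrec_pair_const
    exact Primrec.id
  refine (Primrec.nat_rec₁ (msoCode hintikkaFormula) (hstep.comp₂ Primrec₂.right)).of_eq
    fun d => ?_
  induction d with
  | zero => rfl
  | succ d ih => exact congrArg stepCode ih

theorem computable_msoCode_satSentence : Computable fun d => msoCode (satSentence d) := by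
  have hcode : Primrec fun d => msoCode (satSentence d) := by
    simp only [satSentence, msoCode]
    iterate 4 apply primrec_pair_const
    exact primrec_msoCode_unfoldingFormula
  exact hcode.to_comp

end CTL

theorem mainTheorem3_general :
    ∃ θ : ℕ → MSO CTL.tau,
      Computable (fun d => CTL.msoCode (θ d)) ∧
      (∀ d, (θ d).IsSentence) ∧
      ∀ φ : CTL.Formula, φ.UsesOnly {CTL.opAX, CTL.opEX} →
        ∀ (A : Type) [CTL.tau.Structure A] (ρ : A → CTL.Formula),
          CTL.IsEncoding φ A ρ → (φ.Satisfiable ↔ (θ φ.td).HoldsIn A) :=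
  ⟨CTL.satSentence, CTL.computable_msoCode_satSentence, CTL.isSentence_satSentence,
    fun _ hφ _ _ _ hρ => hρ.satisfiable_iff_holdsIn hφ⟩

/-- There is a computable family `θ 0, θ 1, …` of MSO sentences such that each formula `φ` in
negation normal form over `AX`, `EX` is satisfiable iff the structure `A_φ` (equivalently, any
finite structure that encodes `φ`) satisfies the sentence `θ (td φ)`. -/
theorem mainTheorem3 :
    ∃ θ : ℕ → MSO CTL.tau,
      Computable (fun d => CTL.msoCode (θ d)) ∧
      (∀ d, (θ d).IsSentence) ∧
      ∀ φ ∈ CTL.NNF {CTL.opAX, CTL.opEX},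
        (φ.Satisfiable ↔ (θ φ.td).HoldsIn φ.Univ) ∧
        ∀ (A : Type) [Finite A] [CTL.tau.Structure A] (ρ : A → CTL.Formula),
          CTL.IsEncoding φ A ρ → (φ.Satisfiable ↔ (θ φ.td).HoldsIn A) := by
  obtain ⟨θ, hcomp, hsent, hθ⟩ := mainTheorem3_general
  exact ⟨θ, hcomp, hsent, fun φ hφ => ⟨hθ φ hφ.2 _ _ (CTL.isEncoding_univ φ),
    fun A _ _ ρ hρ => hθ φ hφ.2 A ρ hρ⟩⟩
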